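/- Let $X_1, X_2, \ldots$ be a (strictly) stationary sequence of real random variables on a probability space $(\Omega,\mathcal F,\mathbb P)$, with partial maxima $M_n=\max_{1\le j\le n}X_j$. For $r\in\mathbb N$ let $$\alpha(r)=\sup\ \tfrac14\,\bigl|\operatorname{Cov}\bigl(f(X_{i_1},\ldots,X_{i_s}),\,g(X_{j_1},\ldots,X_{j_t})\bigr)\bigr| ,$$ where the supremum is over all $s,t\ge 1$, all measurable non-constant functions $f:\mathbb R^s\to[-1,1]$, $g:\mathbb R^t\to[-1,1]$, and all indices $i_1\le\cdots\le i_s\le j_1\le\cdots\le j_t$ with $j_1-i_s\ge r$. Suppose that the sequence is $\alpha$-mixing (strongly mixing), i.e. $\alpha(r)\to0$ as $r\to\infty$ (no rate is required), and that the marginal distribution function $F(x)=\mathbb P(X_1\le x)$ is continuous. Then $\{X_j\}$ admits a continuous phantom distribution function: there is a continuous distribution function $G$ of a probability measure on $\mathbb R$ such that $$\mathbb P(M_n\le u_n)-G(u_n)^n\longrightarrow 0\quad\text{as } n\to\infty$$ for every sequence $(u_n)$ of real numbers; equivalently, $\sup_{u\in\mathbb R}\bigl|\mathbb P(M_n\le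 u)-G(u)^n\bigr|\to0$. -/

import Mathlib

open MeasureTheory ProbabilityTheory Filter Topology

namespace Phantom

/-- Strict stationarity of the sequence: for every `k` the shifted sequence `(X_{j+k})_j` has the
same law on the sequence space as `(X_j)_j`. -/
def IsStationary {Ω : Type*} [MeasurableSpace Ω] (P : Measure Ω) (X : ℕ → Ω → ℝ) : Prop :=
  ∀ k : ℕ, IdentDistrib (fun ω j ↦ X (j + k) ω) (fun ω j ↦ X j ω) P P

/-- The class of measurable non-constant functions `f` on `ℝ^s` with `sup |f| ≤ 1`
(non-constancy forces `1 ≤ s`). -/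
def IsTestFunction {s : ℕ} (f : (Fin s → ℝ) → ℝ) : Prop :=
  Measurable f ∧ (∀ x, |f x| ≤ 1) ∧ ∃ x y, f x ≠ f y

/-- The numbers `|Cov(f(X_{i_1}, …, X_{i_s}), g(X_{j_1}, …, X_{j_t}))| / 4`, over all `s, t ≥ 1`, all
test functions `f`, `g` and all indices `i_1 ≤ ⋯ ≤ i_s ≤ j_1 ≤ ⋯ ≤ j_t` with gap
`j_1 - i_s ≥ r`. -/
def alphaSet {Ω : Type*} [MeasurableSpace Ω] (P : Measure Ω) (X : ℕ → Ω → ℝ) (r : ℕ) : Set ℝ :=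
  {c | ∃ (s t : ℕ) (f : (Fin s → ℝ) → ℝ) (g : (Fin t → ℝ) → ℝ) (i : Fin s → ℕ) (j : Fin t → ℕ),
    IsTestFunction f ∧ IsTestFunction g ∧ Monotone i ∧ Monotone j ∧ (∀ a b, i a + r ≤ j b) ∧
    c = |cov[fun ω ↦ f (fun a ↦ X (i a) ω), fun ω ↦ g (fun b ↦ X (j b) ω); P]| / 4}

/-- The `α`-mixing coefficient `α(r)`. -/
noncomputable def alphaCoeff {Ω : Type*} [MeasurableSpace Ω] (P : Measure Ω) (X : ℕ → Ω → ℝ)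
    (r : ℕ) : ℝ :=
  sSup (alphaSet P X r)

/-- `α`-mixing (strong mixing): `α(r) → 0` as `r → ∞`. -/
def IsAlphaMixing {Ω : Type*} [MeasurableSpace Ω] (P : Measure Ω) (X : ℕ → Ω → ℝ) : Prop :=
  Tendsto (alphaCoeff P X) atTop (𝓝 0)

/-- The maximum of the first `n` members `X 0, …, X (n - 1)` of the sequence, for `1 ≤ n`
(the value at `n = 0` is irrelevant). -/
noncomputable def partialMax {Ω : Type*} (X : ℕ → Ω → ℝ) (n : ℕ) (ω : Ω) : ℝ :=
  ⨆ j : Fin n, X j ω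

/-- `G` is the distribution function of some probability measure on `ℝ`. -/
def IsDistributionFunction (G : ℝ → ℝ) : Prop :=
  ∃ ν : Measure ℝ, IsProbabilityMeasure ν ∧ ∀ x, G x = cdf ν x

/-- `G` is a phantom distribution function for the sequence: `P(M_n ≤ u_n) - G(u_n)^n → 0` for every
sequence `(u_n)` of real numbers. -/
def IsPhantomDistributionFunction {Ω : Type*} [MeasurableSpace Ω] (P : Measure Ω)
    (X : ℕ → Ω → ℝ) (G : ℝ → ℝ) : Prop :=
  IsDistributionFunction G ∧
    ∀ u : ℕ → ℝ, Tendsto (fun n ↦ P.real {ω | partialMax X n ω ≤ u n} - G (u n) ^ n) atTop (𝓝 0)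

end Phantom

namespace Phantom

/-! ### Asymptotically geometric sequences -/

section Geometric

variable {ι : Type*} {l : Filter ι} {g : ι → ℕ → ℝ} {ε τ : ι → ℝ}

/-! Write h(u, n) = P(M_n ≤ u) and F(u) = h(u, 1). At a fixed high level, n ↦ h(u, n) is nearly
geometric. It decreases from 1 in steps of at most 1 - F(u). It is also nearly multiplicative,
uniformly in the block lengths: deleting a gap of length r between two blocks costs at most r(1 -
F(u)), and the separated blocks are independent up to 4α(r). Choosing r first and then u with F(u)
close to 1 makes both errors small, so no mixing rate is needed.

A nearly multiplicative decreasing sequence with small steps is determined by the time τ(u) at which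
it crosses exp(-1): it is uniformly close to exp(-n/τ(u)) (`eventually_forall_abs_sub_exp_le`).
Hence G(u) = exp(-1/τ(u)) is the natural phantom. Counting the n with h(u, n) > exp(-1) would make τ
jump, so `timeScale` sums a continuous cutoff whose width 1 - F(u) matches the step bound. This
keeps the value at the crossing time asymptotically exp(-1) (`floor_timeScale`).

Away from F(u) = 1, both h(u, n) and G(u)^n vanish uniformly as n grows, by mixing along widely
spaced times; where F(u) = 1 both equal 1. `eventually_forall_abs_sub_phantom_pow_le` joins the
regimes, and `isMaximumFamily_probBelow` supplies the probabilistic input. -/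

theorem sub_add_le_of_step {a : ℕ → ℝ} {e : ℝ} (hstep : ∀ n, a n - a (n + 1) ≤ e) (n c : ℕ) :
    a n - a (n + c) ≤ c * e := by
  induction c with
  | zero => simp
  | succ c ih =>
    have := hstep (n + c)
    rw [← add_assoc]
    push_cast
    linarith

theorem tendsto_sub_of_bounded_gap (hanti : ∀ i, Antitone (g i))
    (hstep : ∀ i n, g i n - g i (n + 1) ≤ ε i) (hε : Tendsto ε l (𝓝 0)) {a b : ι → ℕ} (C : ℕ)
    (hab : ∀ i, a i ≤ b i) (hba : ∀ i, b i ≤ a i + C) :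
    Tendsto (fun i ↦ g i (a i) - g i (b i)) l (𝓝 0) := by
  have h0 : Tendsto (fun i ↦ C * ε i) l (𝓝 0) := by simpa using hε.const_mul (C : ℝ)
  refine tendsto_of_tendsto_of_tendsto_of_le_of_le tendsto_const_nhds h0 (fun i ↦ ?_) (fun i ↦ ?_)
  · exact sub_nonneg.2 (hanti i (hab i))
  · have h1 := sub_add_le_of_step (hstep i) (a i) C
    have h2 := hanti i (hba i)
    simp only
    linarith

/-- Each of the k factors adds one multiplicativity error. Since k is fixed and that error is
uniform in the block lengths, m may vary arbitrarily with i. -/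
theorem tendsto_mul_sub_pow (h0 : ∀ i, g i 0 = 1) (hnn : ∀ i n, 0 ≤ g i n)
    (hanti : ∀ i, Antitone (g i))
    (hmul : ∀ δ > 0, ∀ᶠ i in l, ∀ p q, |g i (p + q) - g i p * g i q| ≤ δ) (m : ι → ℕ) (k : ℕ) :
    Tendsto (fun i ↦ g i (k * m i) - g i (m i) ^ k) l (𝓝 0) := by
  induction k with
  | zero => simpa [h0] using tendsto_const_nhds
  | succ k ih =>
    have h1 : Tendsto (fun i ↦ g i (k * m i + m i) - g i (k * m i) * g i (m i)) l (𝓝 0) := by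
      rw [Metric.tendsto_nhds]
      intro δ hδ
      filter_upwards [hmul (δ / 2) (by positivity)] with i hi
      rw [dist_zero_right, Real.norm_eq_abs]
      exact (hi _ _).trans_lt (by linarith)
    have h2 : Tendsto (fun i ↦ (g i (k * m i) - g i (m i) ^ k) * g i (m i)) l (𝓝 0) := by
      refine squeeze_zero_norm (fun i ↦ ?_) (by simpa using ih.abs)
      rw [norm_mul, Real.norm_eq_abs, Real.norm_eq_abs, abs_of_nonneg (hnn i (m i))]
      have : g i (m i) ≤ 1 := h0 i ▸ hanti i (Nat.zero_le _)
      exact mul_le_of_le_one_right (abs_nonneg _) this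
    have h3 := h1.add h2
    rw [add_zero] at h3
    refine h3.congr fun i ↦ ?_
    rw [Nat.succ_mul]
    ring

/-- K blocks of length T / K miss T by at most K steps, so the K-th power of the value at T / K
tends to exp(-1). Taking the K-th root and then the p-th power gives the grid values. -/
theorem tendsto_geometric_grid (h0 : ∀ i, g i 0 = 1) (hnn : ∀ i n, 0 ≤ g i n)
    (hanti : ∀ i, Antitone (g i)) (hstep : ∀ i n, g i n - g i (n + 1) ≤ ε i)
    (hmul : ∀ δ > 0, ∀ᶠ i in l, ∀ p q, |g i (p + q) - g i p * g i q| ≤ δ)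
    (hε : Tendsto ε l (𝓝 0)) {T : ι → ℕ}
    (hT : Tendsto (fun i ↦ g i (T i)) l (𝓝 (Real.exp (-1)))) {K : ℕ} (hK : 0 < K) (p : ℕ) :
    Tendsto (fun i ↦ g i (p * (T i / K))) l (𝓝 (Real.exp (-(p * (1 / K))))) := by
  have hK' : (K : ℝ) ≠ 0 := by positivity
  have h1 : Tendsto (fun i ↦ g i (K * (T i / K)) - g i (T i)) l (𝓝 0) :=
    tendsto_sub_of_bounded_gap hanti hstep hε K (fun i ↦ Nat.mul_div_le _ _)
      fun i ↦ (Nat.lt_mul_div_succ (T i) hK).le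
  have h2 : Tendsto (fun i ↦ g i (T i / K) ^ K) l (𝓝 (Real.exp (-1))) := by
    have := (h1.sub (tendsto_mul_sub_pow h0 hnn hanti hmul (fun i ↦ T i / K) K)).add hT
    simpa using this
  have h3 : Tendsto (fun i ↦ g i (T i / K)) l (𝓝 (Real.exp (-(1 / K)))) := by
    have := h2.rpow_const (p := (K : ℝ)⁻¹) (Or.inl (Real.exp_pos _).ne')
    rw [← Real.exp_mul] at this
    refine (this.congr fun i ↦ Real.pow_rpow_inv_natCast (hnn _ _) hK.ne').trans ?_
    rw [one_div, neg_one_mul]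
  have h4 := (tendsto_mul_sub_pow h0 hnn hanti hmul (fun i ↦ T i / K) p).add (h3.pow p)
  rw [← Real.exp_nat_mul, zero_add, mul_neg] at h4
  simpa using h4

theorem exp_neg_sub_exp_neg_le {x y : ℝ} (hx : 0 ≤ x) :
    Real.exp (-x) - Real.exp (-y) ≤ max 0 (y - x) := by
  have h1 : Real.exp (-y) = Real.exp (-x) * Real.exp (x - y) := by
    rw [← Real.exp_add]; ring_nf
  have h2 := Real.add_one_le_exp (x - y)
  have h3 : Real.exp (-x) ≤ 1 := Real.exp_le_one_iff.2 (by linarith)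
  have h4 := Real.exp_pos (-x)
  rw [h1]
  rcases le_total x y with h | h
  · refine le_max_of_le_right ?_
    nlinarith
  · refine le_max_of_le_left ?_
    nlinarith

/-- If the antitone sequences `g i` are asymptotically multiplicative, have asymptotically vanishing
steps, and take values close to `exp (-1)` at the time `τ i`, then they are uniformly close to the
geometric sequences `n ↦ exp (-n / τ i)`. -/
theorem eventually_forall_abs_sub_exp_le (h0 : ∀ i, g i 0 = 1) (hnn : ∀ i n, 0 ≤ g i n)
    (hanti : ∀ i, Antitone (g i)) (hstep : ∀ i n, g i n - g i (n + 1) ≤ ε i)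
    (hmul : ∀ δ > 0, ∀ᶠ i in l, ∀ p q, |g i (p + q) - g i p * g i q| ≤ δ)
    (hε : Tendsto ε l (𝓝 0)) (hτ : Tendsto τ l atTop)
    (hT : Tendsto (fun i ↦ g i ⌊τ i⌋₊) l (𝓝 (Real.exp (-1)))) {δ : ℝ} (hδ : 0 < δ) :
    ∀ᶠ i in l, ∀ n : ℕ, |g i n - Real.exp (-(n / τ i))| ≤ δ := by
  -- Mesh 1/K in units of τ makes exp(-x) vary by less than δ/4 per cell. The grid has K² cells,
  -- reaching time about Kτ, beyond which both sequences are small; it is finite, so all its points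
  -- are controlled at once.
  obtain ⟨K, hKδ⟩ := exists_nat_gt (4 / δ)
  have hK0 : (0 : ℝ) < K := lt_trans (by positivity) hKδ
  have hK : 0 < K := by exact_mod_cast hK0
  have hKδ' : 4 / K < δ := by rwa [div_lt_comm₀ hK0 hδ]
  have hratio : Tendsto (fun i ↦ ((⌊τ i⌋₊ / K : ℕ) : ℝ) / τ i) l (𝓝 (1 / K)) := by
    have := (tendsto_nat_floor_mul_div_atTop (R := ℝ) (a := 1 / K) (by positivity)).comp hτ
    refine this.congr fun i ↦ ?_
    simp only [Function.comp_apply]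
    rw [one_div_mul_eq_div, Nat.floor_div_natCast]
  have hgrid (p : ℕ) : ∀ᶠ i in l, |g i (p * (⌊τ i⌋₊ / K)) -
      Real.exp (-(p * (((⌊τ i⌋₊ / K : ℕ) : ℝ) / τ i)))| < δ / 4 := by
    have h1 := tendsto_geometric_grid h0 hnn hanti hstep hmul hε hT hK p
    have h2 := (Real.continuous_exp.tendsto _).comp (hratio.const_mul (p : ℝ)).neg
    have h3 := h1.sub h2
    rw [sub_self] at h3
    have := Metric.tendsto_nhds.1 h3 (δ / 4) (by positivity)
    simpa [Real.dist_eq] using this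
  have hall : ∀ᶠ i in l, ∀ p ∈ Finset.range (K ^ 2 + 1), |g i (p * (⌊τ i⌋₊ / K)) -
      Real.exp (-(p * (((⌊τ i⌋₊ / K : ℕ) : ℝ) / τ i)))| < δ / 4 :=
    (Filter.eventually_all_finset _).2 fun p _ ↦ hgrid p
  have hhalf : 1 / (2 * (K : ℝ)) < 1 / K := one_div_lt_one_div_of_lt hK0 (by linarith)
  filter_upwards [hall, hratio.eventually_const_lt hhalf,
    hτ.eventually_ge_atTop (K : ℝ)] with i hi hlow hτK n
  have hτ0 : 0 < τ i := hK0.trans_le hτK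
  set m := ⌊τ i⌋₊ / K with hm
  set s : ℝ := (m : ℝ) / τ i with hs
  have hm0 : 0 < m := Nat.div_pos (Nat.le_floor hτK) hK
  have hs0 : 0 < s := by positivity
  have hsup : s ≤ 1 / K := by
    rw [hs, div_le_div_iff₀ hτ0 hK0, one_mul]
    calc (m : ℝ) * K ≤ (⌊τ i⌋₊ : ℝ) := by exact_mod_cast Nat.div_mul_le_self _ _
      _ ≤ τ i := Nat.floor_le hτ0.le
  have hsδ : s < δ / 4 := by
    refine hsup.trans_lt ?_
    have : 4 / (K : ℝ) = 4 * (1 / K) := by ring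
    linarith
  -- Inside the grid, n is squeezed between neighbouring grid points by monotonicity. Beyond it, s >
  -- 1/(2K) bounds the exponential by exp(-K/2) < δ/2.
  rcases lt_or_ge (n / m) (K ^ 2) with hp | hp
  · set p := n / m with hpdef
    have hpn : p * m ≤ n := Nat.div_mul_le_self _ _
    have hnp : n ≤ (p + 1) * m := by
      rw [mul_comm]; exact (Nat.lt_mul_div_succ n hm0).le
    have e1 := hi p (Finset.mem_range.2 (by omega))
    have e2 := hi (p + 1) (Finset.mem_range.2 (by omega))
    have g1 := hanti i hpn
    have g2 := hanti i hnp
    have x1 : p * s ≤ n / τ i := by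
      rw [hs, ← mul_div_assoc]
      gcongr
      exact_mod_cast hpn
    have x2 : n / τ i ≤ ((p + 1 : ℕ) : ℝ) * s := by
      rw [hs, ← mul_div_assoc]
      gcongr
      exact_mod_cast hnp
    have y1 : Real.exp (-(n / τ i)) ≤ Real.exp (-(p * s)) := Real.exp_le_exp.2 (by linarith)
    have y2 : Real.exp (-(((p + 1 : ℕ) : ℝ) * s)) ≤ Real.exp (-(n / τ i)) :=
      Real.exp_le_exp.2 (by linarith)
    have y3 := exp_neg_sub_exp_neg_le (x := p * s) (y := ((p + 1 : ℕ) : ℝ) * s) (by positivity)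
    have y4 : ((p + 1 : ℕ) : ℝ) * s - p * s = s := by push_cast; ring
    rw [y4, max_eq_right hs0.le] at y3
    rw [abs_lt] at e1 e2
    rw [abs_le]
    constructor <;> linarith
  · have hpn : K ^ 2 * m ≤ n := (Nat.mul_le_mul_right m hp).trans (Nat.div_mul_le_self _ _)
    have e1 := (abs_lt.1 (hi (K ^ 2) (Finset.mem_range.2 (by omega)))).2
    have g1 := hanti i hpn
    have x1 : ((K ^ 2 : ℕ) : ℝ) * s ≤ n / τ i := by
      rw [hs, ← mul_div_assoc]
      gcongr
      exact_mod_cast hpn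
    have x2 : (K : ℝ) / 2 ≤ ((K ^ 2 : ℕ) : ℝ) * s := by
      have : (K : ℝ) / 2 = K ^ 2 * (1 / (2 * K)) := by field_simp
      rw [this]
      push_cast
      gcongr
    have y1 : Real.exp (-(n / τ i)) ≤ Real.exp (-(K / 2)) := Real.exp_le_exp.2 (by linarith)
    have y2 : Real.exp (-(((K ^ 2 : ℕ) : ℝ) * s)) ≤ Real.exp (-(K / 2)) :=
      Real.exp_le_exp.2 (by linarith)
    have y3 : Real.exp (-((K : ℝ) / 2)) < δ / 2 := by
      rw [Real.exp_neg]
      have h1 := Real.add_one_le_exp ((K : ℝ) / 2)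
      have h2 : (Real.exp ((K : ℝ) / 2))⁻¹ ≤ ((K : ℝ) / 2)⁻¹ := by
        gcongr
        linarith
      have h3 : ((K : ℝ) / 2)⁻¹ = 4 / K / 2 := by field_simp; norm_num
      linarith
    have y4 := Real.exp_pos (-(n / τ i))
    have y5 := hnn i n
    rw [abs_le]
    constructor <;> linarith

end Geometric

/-! ### The phantom distribution function of a family of maximum laws -/

/-- The properties of the probabilities `h u n` that the first `n` members of a stationary,
strongly mixing sequence with a continuous marginal do not exceed `u`. -/
structure IsMaximumFamily (h : ℝ → ℕ → ℝ) : Prop where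
  zero : ∀ u, h u 0 = 1
  nonneg : ∀ u n, 0 ≤ h u n
  anti : ∀ u, Antitone (h u)
  mono : ∀ n, Monotone fun u ↦ h u n
  cont : ∀ n, Continuous fun u ↦ h u n
  step : ∀ u n, h u n - h u (n + 1) ≤ 1 - h u 1
  approx_mul : ∀ δ > 0, ∃ η > 0, ∀ u, 1 - h u 1 < η → ∀ p q, |h u (p + q) - h u p * h u q| ≤ δ
  decay : ∀ η > 0, ∀ δ > 0, ∃ N, ∀ u, h u 1 ≤ 1 - η → h u N ≤ δ
  lim_atBot : Tendsto (fun u ↦ h u 1) atBot (𝓝 0)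
  lim_atTop : Tendsto (fun u ↦ h u 1) atTop (𝓝 1)

/-- The continuous cutoff which is `0` for `x ≤ exp (-1)` and `1` for `exp (-1) + d ≤ x`. -/
noncomputable def cutoff (d x : ℝ) : ℝ := max 0 (min 1 ((x - Real.exp (-1)) / d))

theorem cutoff_nonneg (d x : ℝ) : 0 ≤ cutoff d x := le_max_left _ _

theorem cutoff_le_one (d x : ℝ) : cutoff d x ≤ 1 := max_le zero_le_one (min_le_left _ _)

theorem cutoff_eq_zero {d x : ℝ} (hd : 0 < d) (hx : x ≤ Real.exp (-1)) : cutoff d x = 0 :=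
  max_eq_left (min_le_of_right_le (div_nonpos_of_nonpos_of_nonneg (by linarith) hd.le))

theorem cutoff_eq_one {d x : ℝ} (hd : 0 < d) (hx : Real.exp (-1) + d ≤ x) : cutoff d x = 1 := by
  have : 1 ≤ (x - Real.exp (-1)) / d := by rw [le_div_iff₀ hd]; linarith
  rw [cutoff, min_eq_left this, max_eq_right zero_le_one]

/-- Narrowing the ramp raises the cutoff because its left end stays at exp(-1). As u increases, the
width 1 - h u 1 shrinks while h u n grows, so `timeScale` is monotone. -/
theorem cutoff_le_cutoff {d d' x x' : ℝ} (hd' : 0 < d') (hd : d' ≤ d) (hx : x ≤ x') :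
    cutoff d x ≤ cutoff d' x' := by
  rcases le_or_gt x (Real.exp (-1)) with h | h
  · rw [cutoff_eq_zero (hd'.trans_le hd) h]
    exact cutoff_nonneg _ _
  · refine max_le_max le_rfl (min_le_min le_rfl ?_)
    have : 0 ≤ x' - Real.exp (-1) := by linarith
    gcongr

theorem expNegInvGlue_le_one (x : ℝ) : expNegInvGlue x ≤ 1 := by
  rw [expNegInvGlue]
  split_ifs with hx
  · exact zero_le_one
  · exact Real.exp_le_one_iff.2 (neg_nonpos.2 (inv_nonneg.2 (not_le.1 hx).le))

theorem monotone_expNegInvGlue : Monotone expNegInvGlue := by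
  intro x y hxy
  rcases le_or_gt x 0 with hx | hx
  · rw [expNegInvGlue.zero_of_nonpos hx]
    exact expNegInvGlue.nonneg _
  · rw [expNegInvGlue, expNegInvGlue, if_neg hx.not_ge, if_neg (hx.trans_le hxy).not_ge]
    gcongr

theorem one_sub_inv_le_expNegInvGlue {N : ℕ} (hN : 0 < N) :
    1 - 1 / (N : ℝ) ≤ expNegInvGlue N := by
  have : (0 : ℝ) < N := by exact_mod_cast hN
  rw [expNegInvGlue, if_neg this.not_ge, one_div]
  have := Real.add_one_le_exp (-(N : ℝ)⁻¹)
  linarith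

/-- A continuous version of the number of `n ≥ 1` with `exp (-1) < h u n`. -/
noncomputable def timeScale (h : ℝ → ℕ → ℝ) (u : ℝ) : ℝ :=
  ∑' n, cutoff (1 - h u 1) (h u (n + 1))

/-- The phantom distribution function: `exp (-1 / timeScale h u)`, with the values `0` and `1` where
the time scale is zero and infinite. -/
noncomputable def phantom (h : ℝ → ℕ → ℝ) (u : ℝ) : ℝ :=
  if h u 1 < 1 then expNegInvGlue (timeScale h u) else 1

namespace IsMaximumFamily

variable {h : ℝ → ℕ → ℝ}

theorem le_one (hh : IsMaximumFamily h) (u : ℝ) (n : ℕ) : h u n ≤ 1 :=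
  hh.zero u ▸ hh.anti u (Nat.zero_le n)

theorem eq_one (hh : IsMaximumFamily h) {u : ℝ} (hu : h u 1 = 1) (n : ℕ) : h u n = 1 := by
  refine le_antisymm (hh.le_one u n) ?_
  have := sub_add_le_of_step (hh.step u) 0 n
  rw [hu, sub_self, mul_zero, zero_add, hh.zero] at this
  linarith

/-! ### Truncation, monotonicity and continuity of the time scale -/

theorem timeScale_eq_sum (hh : IsMaximumFamily h) {u : ℝ} (hu : h u 1 < 1) {N : ℕ}
    (hN : h u (N + 1) ≤ Real.exp (-1)) :
    timeScale h u = ∑ n ∈ Finset.range N, cutoff (1 - h u 1) (h u (n + 1)) := by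
  refine tsum_eq_sum fun n hn ↦ cutoff_eq_zero (by linarith) ?_
  rw [Finset.mem_range, not_lt] at hn
  exact (hh.anti u (by omega)).trans hN

theorem timeScale_le (hh : IsMaximumFamily h) {u : ℝ} (hu : h u 1 < 1) {N : ℕ}
    (hN : h u (N + 1) ≤ Real.exp (-1)) : timeScale h u ≤ N := by
  rw [hh.timeScale_eq_sum hu hN]
  refine (Finset.sum_le_sum fun n _ ↦ cutoff_le_one _ _).trans ?_
  simp

theorem exists_le_exp (hh : IsMaximumFamily h) {η : ℝ} (hη : 0 < η) :
    ∃ N, ∀ u, h u 1 ≤ 1 - η → h u (N + 1) ≤ Real.exp (-1) := by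
  obtain ⟨N, hN⟩ := hh.decay η hη (Real.exp (-1)) (Real.exp_pos _)
  exact ⟨N, fun u hu ↦ (hh.anti u N.le_succ).trans (hN u hu)⟩

theorem le_timeScale (hh : IsMaximumFamily h) {u : ℝ} (hu : h u 1 < 1) {N : ℕ}
    (hN : Real.exp (-1) + (1 - h u 1) ≤ h u N) : (N : ℝ) ≤ timeScale h u := by
  obtain ⟨M, hM⟩ := hh.exists_le_exp (η := 1 - h u 1) (by linarith)
  have hM := hM u (by linarith)
  have hNM : N ≤ M := by
    by_contra! hlt
    have := hh.anti u (show M + 1 ≤ N by omega)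
    linarith
  rw [hh.timeScale_eq_sum hu hM]
  calc (N : ℝ) = ∑ n ∈ Finset.range N, cutoff (1 - h u 1) (h u (n + 1)) := by
        rw [Finset.sum_congr rfl fun n hn ↦ cutoff_eq_one (x := h u (n + 1)) (by linarith)
          (hN.trans (hh.anti u (by rw [Finset.mem_range] at hn; omega)))]
        simp
    _ ≤ _ := Finset.sum_le_sum_of_subset_of_nonneg (Finset.range_subset_range.2 hNM)
        fun _ _ _ ↦ cutoff_nonneg _ _

theorem timeScale_nonneg (h : ℝ → ℕ → ℝ) (u : ℝ) : 0 ≤ timeScale h u :=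
  tsum_nonneg fun _ ↦ cutoff_nonneg _ _

theorem timeScale_mono (hh : IsMaximumFamily h) {u v : ℝ} (huv : u ≤ v) (hv : h v 1 < 1) :
    timeScale h u ≤ timeScale h v := by
  obtain ⟨M, hM⟩ := hh.exists_le_exp (η := 1 - h v 1) (by linarith)
  have h1 : h u 1 ≤ h v 1 := hh.mono 1 huv
  rw [hh.timeScale_eq_sum hv (hM v (by linarith)),
    hh.timeScale_eq_sum (h1.trans_lt hv) (hM u (by linarith))]
  exact Finset.sum_le_sum fun n _ ↦ cutoff_le_cutoff (by linarith) (by linarith) (hh.mono _ huv)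

theorem continuousAt_timeScale (hh : IsMaximumFamily h) {u : ℝ} (hu : h u 1 < 1) :
    ContinuousAt (timeScale h) u := by
  -- Halving the distance to 1 leaves room for a neighbourhood of u on which one truncation index M
  -- serves every v.
  obtain ⟨M, hM⟩ := hh.exists_le_exp (η := (1 - h u 1) / 2) (by linarith)
  have hev : ∀ᶠ v in 𝓝 u, h v 1 < 1 - (1 - h u 1) / 2 :=
    (hh.cont 1).continuousAt.eventually_lt_const (by linarith)
  have heq : timeScale h =ᶠ[𝓝 u]
      fun v ↦ ∑ n ∈ Finset.range M, cutoff (1 - h v 1) (h v (n + 1)) := by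
    filter_upwards [hev] with v hv
    exact hh.timeScale_eq_sum (by linarith) (hM v hv.le)
  refine ContinuousAt.congr ?_ heq.symm
  refine tendsto_finsetSum _ fun n _ ↦ ?_
  have h1 : ContinuousAt (fun v ↦ h v (n + 1)) u := (hh.cont _).continuousAt
  have h2 : ContinuousAt (fun v ↦ h v 1) u := (hh.cont _).continuousAt
  exact ContinuousAt.sup continuousAt_const (ContinuousAt.inf continuousAt_const
    ((h1.sub continuousAt_const).div (continuousAt_const.sub h2) (by linarith)))

/-- The time scale is large where the marginal distribution function is close to one. -/
theorem exists_forall_le_timeScale (hh : IsMaximumFamily h) (N : ℕ) :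
    ∃ η > 0, ∀ u, 1 - η < h u 1 → h u 1 < 1 → (N : ℝ) ≤ timeScale h u := by
  have he : Real.exp (-1) < 1 := by rw [Real.exp_lt_one_iff]; norm_num
  -- N steps and one cutoff width, each at most 1 - h u 1, must fit between exp(-1) and 1; hence N +
  -- 1.
  refine ⟨(1 - Real.exp (-1)) / (N + 1), div_pos (by linarith) (by positivity), fun u hu hu1 ↦ ?_⟩
  refine hh.le_timeScale hu1 ?_
  have h1 := sub_add_le_of_step (hh.step u) 0 N
  rw [zero_add, hh.zero] at h1
  have h2 : 1 - h u 1 < (1 - Real.exp (-1)) / (N + 1) := by linarith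
  rw [lt_div_iff₀ (by positivity)] at h2
  linarith

/-! ### The phantom as a continuous distribution function -/

theorem phantom_nonneg (h : ℝ → ℕ → ℝ) (u : ℝ) : 0 ≤ phantom h u := by
  rw [phantom]
  split_ifs
  · exact expNegInvGlue.nonneg _
  · exact zero_le_one

theorem phantom_le_one (h : ℝ → ℕ → ℝ) (u : ℝ) : phantom h u ≤ 1 := by
  rw [phantom]
  split_ifs
  · exact expNegInvGlue_le_one _
  · exact le_rfl

theorem monotone_phantom (hh : IsMaximumFamily h) : Monotone (phantom h) := by
  intro u v huv
  by_cases hv : h v 1 < 1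
  · have hu : h u 1 < 1 := (hh.mono 1 huv).trans_lt hv
    rw [phantom, phantom, if_pos hu, if_pos hv]
    exact monotone_expNegInvGlue (hh.timeScale_mono huv hv)
  · conv_rhs => rw [phantom, if_neg hv]
    exact phantom_le_one h u

/-- The phantom distribution function is close to one where the marginal one is. -/
theorem tendsto_phantom_one (hh : IsMaximumFamily h) {l : Filter ℝ}
    (hl : Tendsto (fun u ↦ h u 1) l (𝓝 1)) : Tendsto (phantom h) l (𝓝 1) := by
  refine tendsto_order.2 ⟨fun a ha ↦ ?_, fun a ha ↦ .of_forall fun u ↦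
    (phantom_le_one h u).trans_lt ha⟩
  obtain ⟨N, hN⟩ := exists_nat_gt (1 / (1 - a))
  have hN0 : (0 : ℝ) < N := lt_trans (by simpa using ha) hN
  have hN' : 1 / (N : ℝ) < 1 - a := by rwa [div_lt_comm₀ hN0 (by linarith)]
  obtain ⟨η, hη, hτ⟩ := hh.exists_forall_le_timeScale N
  filter_upwards [hl.eventually_const_lt (u := 1 - η) (by linarith)] with u hu
  rw [phantom]
  split_ifs with hu1
  · have h1 := monotone_expNegInvGlue (hτ u hu hu1)
    have h2 := one_sub_inv_le_expNegInvGlue (N := N) (by exact_mod_cast hN0)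
    linarith
  · exact ha

theorem continuous_phantom (hh : IsMaximumFamily h) : Continuous (phantom h) := by
  rw [continuous_iff_continuousAt]
  intro u
  rcases (hh.le_one u 1).lt_or_eq with hu | hu
  · have heq : phantom h =ᶠ[𝓝 u] fun v ↦ expNegInvGlue (timeScale h v) := by
      filter_upwards [(hh.cont 1).continuousAt.eventually_lt_const hu] with v hv
      rw [phantom, if_pos hv]
    refine ContinuousAt.congr ?_ heq.symm
    exact (expNegInvGlue.contDiff (n := 0)).continuous.continuousAt.comp
      (hh.continuousAt_timeScale hu)
  · have hu' : phantom h u = 1 := by rw [phantom, if_neg hu.not_lt]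
    rw [ContinuousAt, hu']
    exact hh.tendsto_phantom_one (hu ▸ (hh.cont 1).tendsto u)

theorem tendsto_phantom_atBot (hh : IsMaximumFamily h) : Tendsto (phantom h) atBot (𝓝 0) := by
  have he : Real.exp (-1) < 1 := by rw [Real.exp_lt_one_iff]; norm_num
  refine tendsto_const_nhds.congr' ?_
  filter_upwards [hh.lim_atBot.eventually_lt_const (Real.exp_pos (-1))] with u hu
  have hu1 : h u 1 < 1 := hu.trans he
  have h1 := hh.timeScale_le hu1 (N := 0) hu.le
  rw [phantom, if_pos hu1, expNegInvGlue.zero_of_nonpos (by simpa using h1)]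

theorem isDistributionFunction_phantom (hh : IsMaximumFamily h) :
    IsDistributionFunction (phantom h) := by
  let f : StieltjesFunction ℝ :=
    ⟨phantom h, hh.monotone_phantom, fun x ↦ hh.continuous_phantom.continuousWithinAt⟩
  have h0 : Tendsto f atBot (𝓝 0) := hh.tendsto_phantom_atBot
  have h1 : Tendsto f atTop (𝓝 1) := hh.tendsto_phantom_one hh.lim_atTop
  refine ⟨f.measure, ⟨by rw [f.measure_univ h0 h1, sub_zero, ENNReal.ofReal_one]⟩, fun x ↦ ?_⟩
  rw [cdf_measure_stieltjesFunction f h0 h1]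

/-! ### Comparison of the maximum laws with powers of the phantom -/

theorem floor_timeScale (hh : IsMaximumFamily h) {u : ℝ} (hu : h u 1 < 1) :
    Real.exp (-1) ≤ h u ⌊timeScale h u⌋₊ ∧
      h u ⌊timeScale h u⌋₊ ≤ Real.exp (-1) + 2 * (1 - h u 1) := by
  have he : Real.exp (-1) < 1 := by rw [Real.exp_lt_one_iff]; norm_num
  set N := ⌊timeScale h u⌋₊ with hN
  constructor
  -- Were the value at N = M + 1 below exp(-1), all terms from index M on would vanish, giving
  -- `timeScale h u ≤ M < N`.
  · by_contra! hlt
    rcases Nat.eq_zero_or_pos N with h0 | h0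
    · rw [h0, hh.zero] at hlt
      linarith
    · obtain ⟨M, hM⟩ := Nat.exists_eq_succ_of_ne_zero h0.ne'
      rw [hM] at hlt
      have h1 := hh.timeScale_le hu hlt.le
      have h2 := Nat.floor_le (timeScale_nonneg h u)
      rw [← hN, hM] at h2
      push_cast at h2
      linarith
  -- One further step would still leave the value a full cutoff width above exp(-1), forcing `N + 1
  -- ≤ timeScale h u`.
  · by_contra! hlt
    have h1 := hh.step u N
    have h2 := hh.le_timeScale hu (N := N + 1) (by linarith)
    have h3 := Nat.lt_floor_add_one (timeScale h u)
    rw [← hN] at h3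
    push_cast at h2
    linarith

/-- Where the marginal distribution function is close to one, the powers of the phantom distribution
function are uniformly close to the given maximum laws. -/
theorem exists_forall_abs_sub_phantom_pow_le (hh : IsMaximumFamily h) {δ : ℝ} (hδ : 0 < δ) :
    ∃ η > 0, ∀ u, 1 - η < h u 1 → h u 1 < 1 → ∀ n : ℕ, |h u n - phantom h u ^ n| ≤ δ := by
  -- Convergence along this filter encodes uniformity over all levels with marginal value just below
  -- 1.
  let l : Filter ℝ := comap (fun u ↦ h u 1) (𝓝[<] 1)
  have hl (p : ℝ → Prop) : (∀ᶠ u in l, p u) ↔ ∃ η > 0, ∀ u, 1 - η < h u 1 → h u 1 < 1 → p u := by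
    rw [Filter.eventually_comap, ((nhdsLT_basis (1 : ℝ)).eventually_iff)]
    constructor
    · rintro ⟨a, ha, H⟩
      exact ⟨1 - a, sub_pos.2 ha, fun u h1 h2 ↦ H ⟨by linarith, h2⟩ u rfl⟩
    · rintro ⟨η, hη, H⟩
      refine ⟨1 - η, by linarith, ?_⟩
      rintro x ⟨h1, h2⟩ u rfl
      exact H u h1 h2
  have hlt : ∀ᶠ u in l, h u 1 < 1 := (hl _).2 ⟨1, one_pos, fun u _ hu ↦ hu⟩
  have hl1 : Tendsto (fun u ↦ h u 1) l (𝓝 1) := tendsto_comap.mono_right nhdsWithin_le_nhds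
  have hε : Tendsto (fun u ↦ 1 - h u 1) l (𝓝 0) := by simpa using hl1.const_sub 1
  have hτ : Tendsto (timeScale h) l atTop := by
    refine tendsto_atTop.2 fun b ↦ ?_
    obtain ⟨N, hN⟩ := exists_nat_ge b
    obtain ⟨η, hη, H⟩ := hh.exists_forall_le_timeScale N
    exact (hl _).2 ⟨η, hη, fun u h1 h2 ↦ hN.trans (H u h1 h2)⟩
  have hT : Tendsto (fun u ↦ h u ⌊timeScale h u⌋₊) l (𝓝 (Real.exp (-1))) := by
    have hup : Tendsto (fun u ↦ Real.exp (-1) + 2 * (1 - h u 1)) l (𝓝 (Real.exp (-1))) := by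
      simpa using (hε.const_mul 2).const_add (Real.exp (-1))
    refine tendsto_of_tendsto_of_tendsto_of_le_of_le' tendsto_const_nhds hup ?_ ?_
    · filter_upwards [hlt] with u hu using (hh.floor_timeScale hu).1
    · filter_upwards [hlt] with u hu using (hh.floor_timeScale hu).2
  have hmul : ∀ δ > 0, ∀ᶠ u in l, ∀ p q, |h u (p + q) - h u p * h u q| ≤ δ := by
    intro δ hδ
    obtain ⟨η, hη, H⟩ := hh.approx_mul δ hδ
    exact (hl _).2 ⟨η, hη, fun u h1 _ ↦ H u (by linarith)⟩
  rw [← hl]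
  filter_upwards [eventually_forall_abs_sub_exp_le hh.zero hh.nonneg hh.anti hh.step hmul hε hτ hT
    hδ, hlt, hτ.eventually_gt_atTop 0] with u hu hu1 hu0 n
  have : phantom h u ^ n = Real.exp (-(n / timeScale h u)) := by
    rw [phantom, if_pos hu1, expNegInvGlue, if_neg hu0.not_ge, ← Real.exp_nat_mul]
    ring_nf
  rw [this]
  exact hu n

theorem eventually_forall_abs_sub_phantom_pow_le (hh : IsMaximumFamily h) {δ : ℝ} (hδ : 0 < δ) :
    ∀ᶠ n : ℕ in atTop, ∀ u, |h u n - phantom h u ^ n| ≤ δ := by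
  obtain ⟨η, hη, H⟩ := hh.exists_forall_abs_sub_phantom_pow_le hδ
  obtain ⟨N, hN⟩ := hh.decay η hη δ hδ
  obtain ⟨M, hM⟩ := hh.exists_le_exp hη
  have hlim : Tendsto (fun n : ℕ ↦ expNegInvGlue (M + 1) ^ n) atTop (𝓝 0) := by
    refine tendsto_pow_atTop_nhds_zero_of_lt_one (expNegInvGlue.nonneg _) ?_
    have hpos : (0 : ℝ) < M + 1 := by positivity
    rw [expNegInvGlue, if_neg hpos.not_ge, Real.exp_lt_one_iff]
    exact neg_neg_of_pos (inv_pos.2 hpos)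
  filter_upwards [eventually_ge_atTop N, hlim.eventually_lt_const hδ] with n hn hpow u
  rcases (hh.le_one u 1).lt_or_eq with hu | hu
  · rcases lt_or_ge (1 - η) (h u 1) with hu' | hu'
    · exact H u hu' hu n
    · have h1 := (hh.anti u hn).trans (hN u hu')
      have h2 : phantom h u ≤ expNegInvGlue (M + 1) := by
        rw [phantom, if_pos hu]
        exact monotone_expNegInvGlue ((hh.timeScale_le hu (hM u hu')).trans (by linarith))
      have h3 := pow_le_pow_left₀ (phantom_nonneg h u) h2 n
      have h4 := pow_nonneg (phantom_nonneg h u) n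
      have h5 := hh.nonneg u n
      rw [abs_le]
      constructor <;> linarith
  · rw [hh.eq_one hu, phantom, if_neg hu.not_lt, one_pow, sub_self, abs_zero]
    exact hδ.le

end IsMaximumFamily

/-! ### Maxima of stationary strongly mixing sequences -/

section Block

variable {Ω : Type*}

/-- The event that none of `X a, …, X (a + n - 1)` exceeds `u`. -/
def blockBelow (X : ℕ → Ω → ℝ) (u : ℝ) (a n : ℕ) : Set Ω := {ω | ∀ j < n, X (j + a) ω ≤ u}

theorem blockBelow_add (X : ℕ → Ω → ℝ) (u : ℝ) (p q : ℕ) :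
    blockBelow X u 0 (p + q) = blockBelow X u 0 p ∩ blockBelow X u p q := by
  ext ω
  simp only [blockBelow, Set.mem_ofPred_eq, Set.mem_inter_iff, add_zero]
  constructor
  · exact fun H ↦ ⟨fun j hj ↦ H j (by omega), fun j hj ↦ H (j + p) (by omega)⟩
  · rintro ⟨H1, H2⟩ j hj
    rcases lt_or_ge j p with h | h
    · exact H1 j h
    · simpa [Nat.sub_add_cancel h] using H2 (j - p) (by omega)

theorem setOf_partialMax_le (X : ℕ → Ω → ℝ) (u : ℝ) {n : ℕ} (hn : 0 < n) :
    {ω | partialMax X n ω ≤ u} = blockBelow X u 0 n := by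
  have : Nonempty (Fin n) := ⟨⟨0, hn⟩⟩
  ext ω
  simp only [partialMax, blockBelow, Set.mem_ofPred_eq, add_zero]
  rw [ciSup_le_iff (Set.finite_range _).bddAbove]
  exact ⟨fun H j hj ↦ H ⟨j, hj⟩, fun H j ↦ H j j.2⟩

theorem indicator_blockBelow (X : ℕ → Ω → ℝ) (u : ℝ) (a n : ℕ) :
    (fun ω ↦ {x : Fin n → ℝ | ∀ a, x a ≤ u}.indicator (1 : (Fin n → ℝ) → ℝ)
      (fun b ↦ X (b + a) ω)) = (blockBelow X u a n).indicator 1 := by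
  ext ω
  simp only [Set.indicator_apply, blockBelow, Set.mem_ofPred_eq, Pi.one_apply, Fin.forall_iff]

end Block

/-! ### Stationarity and mixing estimates for block probabilities -/

section Mixing

variable {Ω : Type*} [MeasurableSpace Ω] {P : Measure Ω} {X : ℕ → Ω → ℝ}

/-- The probability that none of `X 0, …, X (n - 1)` exceeds `u`. -/
noncomputable def probBelow (P : Measure Ω) (X : ℕ → Ω → ℝ) (u : ℝ) (n : ℕ) : ℝ :=
  P.real (blockBelow X u 0 n)

theorem measurableSet_blockBelow (hX : ∀ j, Measurable (X j)) (u : ℝ) (a n : ℕ) :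
    MeasurableSet (blockBelow X u a n) := by
  have : blockBelow X u a n = ⋂ j, ⋂ _ : j < n, {ω | X (j + a) ω ≤ u} := by
    ext ω; simp [blockBelow]
  rw [this]
  exact .iInter fun j ↦ .iInter fun _ ↦ measurableSet_le (hX _) measurable_const

theorem measureReal_blockBelow (hstat : IsStationary P X) (u : ℝ) (a n : ℕ) :
    P.real (blockBelow X u a n) = probBelow P X u n := by
  have hS : MeasurableSet {x : ℕ → ℝ | ∀ j < n, x j ≤ u} := by
    have : {x : ℕ → ℝ | ∀ j < n, x j ≤ u} = ⋂ j, ⋂ _ : j < n, {x | x j ≤ u} := by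
      ext x; simp
    rw [this]
    exact .iInter fun j ↦ .iInter fun _ ↦ measurableSet_le (measurable_pi_apply j) measurable_const
  exact congrArg ENNReal.toReal ((hstat a).measure_mem_eq hS)

theorem probBelow_one (P : Measure Ω) (X : ℕ → Ω → ℝ) (u : ℝ) :
    probBelow P X u 1 = P.real {ω | X 0 ω ≤ u} := by
  simp [probBelow, blockBelow]

variable [IsProbabilityMeasure P]

theorem probBelow_zero (P : Measure Ω) [IsProbabilityMeasure P] (X : ℕ → Ω → ℝ) (u : ℝ) :
    probBelow P X u 0 = 1 := by
  simp [probBelow, blockBelow]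

theorem probBelow_le_one (P : Measure Ω) [IsProbabilityMeasure P] (X : ℕ → Ω → ℝ) (u : ℝ)
    (n : ℕ) : probBelow P X u n ≤ 1 :=
  measureReal_le_one

theorem antitone_probBelow (P : Measure Ω) [IsProbabilityMeasure P] (X : ℕ → Ω → ℝ) (u : ℝ) :
    Antitone (probBelow P X u) :=
  fun _ _ hmn ↦ measureReal_mono fun _ hω j hj ↦ hω j (hj.trans_le hmn)

theorem monotone_probBelow (P : Measure Ω) [IsProbabilityMeasure P] (X : ℕ → Ω → ℝ) (n : ℕ) :
    Monotone fun u ↦ probBelow P X u n :=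
  fun _ _ huv ↦ measureReal_mono fun _ hω j hj ↦ (hω j hj).trans huv

/-- Removing the restriction on the block `B` of length `r` changes probabilities by at most the
probability of an exceedance in that block. -/
theorem measureReal_sub_inter_le (hX : ∀ j, Measurable (X j)) (hstat : IsStationary P X) (u : ℝ)
    (A : Set Ω) (a r : ℕ) :
    P.real A - P.real (A ∩ blockBelow X u a r) ≤ 1 - probBelow P X u r := by
  have h1 := measureReal_sdiff_add_inter (μ := P) (s := A) (measurableSet_blockBelow hX u a r)
  have h2 : P.real (A \ blockBelow X u a r) ≤ P.real (blockBelow X u a r)ᶜ :=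
    measureReal_mono fun ω hω ↦ hω.2
  rw [probReal_compl_eq_one_sub (measurableSet_blockBelow hX u a r),
    measureReal_blockBelow hstat] at h2
  linarith

theorem probBelow_sub_add_le (hX : ∀ j, Measurable (X j)) (hstat : IsStationary P X) (u : ℝ)
    (n r : ℕ) : probBelow P X u n - probBelow P X u (n + r) ≤ 1 - probBelow P X u r := by
  rw [probBelow, probBelow, blockBelow_add]
  exact measureReal_sub_inter_le hX hstat u _ n r

theorem one_sub_probBelow_le (hX : ∀ j, Measurable (X j)) (hstat : IsStationary P X) (u : ℝ)
    (r : ℕ) : 1 - probBelow P X u r ≤ r * (1 - probBelow P X u 1) := by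
  have := sub_add_le_of_step (fun n ↦ probBelow_sub_add_le hX hstat u n 1) 0 r
  rwa [zero_add, probBelow_zero] at this

/-- If the maximum lies in (u, v], some X_j does; a union bound and stationarity finish. Continuity
in u for every n thus reduces to that of the marginal. -/
theorem probBelow_sub_le (hX : ∀ j, Measurable (X j)) (hstat : IsStationary P X) {u v : ℝ}
    (huv : u ≤ v) (n : ℕ) :
    probBelow P X v n - probBelow P X u n ≤ n * (probBelow P X v 1 - probBelow P X u 1) := by
  have hsub (a m : ℕ) : blockBelow X u a m ⊆ blockBelow X v a m :=
    fun _ hω j hj ↦ (hω j hj).trans huv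
  have hdiff (a m : ℕ) : P.real (blockBelow X v a m \ blockBelow X u a m) =
      probBelow P X v m - probBelow P X u m := by
    rw [measureReal_sdiff (hsub a m) (measurableSet_blockBelow hX u a m),
      measureReal_blockBelow hstat, measureReal_blockBelow hstat]
  rw [← hdiff 0 n]
  calc P.real (blockBelow X v 0 n \ blockBelow X u 0 n)
      ≤ P.real (⋃ j ∈ Finset.range n, blockBelow X v j 1 \ blockBelow X u j 1) := by
        refine measureReal_mono (fun ω hω ↦ ?_) (measure_ne_top P _)
        obtain ⟨h1, h2⟩ := hω
        simp only [blockBelow, Set.mem_ofPred_eq, add_zero, not_forall] at h1 h2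
        obtain ⟨j, hj, hju⟩ := h2
        simp only [Set.mem_iUnion, Finset.mem_range]
        exact ⟨j, hj, by simpa [blockBelow] using h1 j hj, by simpa [blockBelow] using hju⟩
    _ ≤ ∑ j ∈ Finset.range n, P.real (blockBelow X v j 1 \ blockBelow X u j 1) :=
        measureReal_biUnion_finset_le _ _
    _ = n * (probBelow P X v 1 - probBelow P X u 1) := by
        simp only [hdiff, Finset.sum_const, Finset.card_range, nsmul_eq_mul]

theorem continuous_probBelow (hX : ∀ j, Measurable (X j)) (hstat : IsStationary P X)
    (hcont : Continuous fun x : ℝ ↦ P.real {ω | X 0 ω ≤ x}) (n : ℕ) :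
    Continuous fun u ↦ probBelow P X u n := by
  have hF : Continuous fun u ↦ probBelow P X u 1 := by simpa only [probBelow_one] using hcont
  have hle (u v : ℝ) : |probBelow P X v n - probBelow P X u n| ≤
      n * |probBelow P X v 1 - probBelow P X u 1| := by
    rcases le_total u v with h | h
    · rw [abs_of_nonneg (sub_nonneg.2 (monotone_probBelow P X n h)),
        abs_of_nonneg (sub_nonneg.2 (monotone_probBelow P X 1 h))]
      exact probBelow_sub_le hX hstat h n
    · rw [abs_sub_comm, abs_sub_comm (probBelow P X v 1),
        abs_of_nonneg (sub_nonneg.2 (monotone_probBelow P X n h)),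
        abs_of_nonneg (sub_nonneg.2 (monotone_probBelow P X 1 h))]
      exact probBelow_sub_le hX hstat h n
  rw [continuous_iff_continuousAt]
  intro u
  rw [ContinuousAt, tendsto_iff_norm_sub_tendsto_zero]
  have h0 : Tendsto (fun v ↦ n * |probBelow P X v 1 - probBelow P X u 1|) (𝓝 u) (𝓝 0) := by
    have := ((hF.tendsto u).sub_const (probBelow P X u 1)).abs.const_mul (n : ℝ)
    simpa using this
  exact squeeze_zero (fun _ ↦ norm_nonneg _) (hle u) h0

/-- Needed because the real `sSup` bounds the members of a set only when that set is bounded above.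
-/
theorem alphaSet_bddAbove (P : Measure Ω) [IsProbabilityMeasure P] (X : ℕ → Ω → ℝ) (r : ℕ) :
    BddAbove (alphaSet P X r) := by
  refine ⟨1, ?_⟩
  rintro c ⟨s, t, f, g, i, j, hf, hg, -, -, -, rfl⟩
  have hdev (φ : Ω → ℝ) (hφ : ∀ ω, |φ ω| ≤ 1) (ω : Ω) : |φ ω - P[φ]| ≤ 2 := by
    have h1 : ‖P[φ]‖ ≤ 1 * P.real Set.univ :=
      norm_integral_le_of_norm_le_const (.of_forall hφ)
    rw [probReal_univ, mul_one, Real.norm_eq_abs] at h1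
    have h2 := abs_sub (φ ω) P[φ]
    have h3 := hφ ω
    linarith
  have hcov : ‖cov[fun ω ↦ f (fun a ↦ X (i a) ω), fun ω ↦ g (fun b ↦ X (j b) ω); P]‖ ≤
      4 * P.real Set.univ := by
    refine norm_integral_le_of_norm_le_const (.of_forall fun ω ↦ ?_)
    rw [norm_mul, Real.norm_eq_abs, Real.norm_eq_abs]
    have h1 := hdev _ (fun ω ↦ hf.2.1 fun a ↦ X (i a) ω) ω
    have h2 := hdev _ (fun ω ↦ hg.2.1 fun b ↦ X (j b) ω) ω
    calc _ ≤ (2 : ℝ) * 2 := mul_le_mul h1 h2 (abs_nonneg _) zero_le_two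
      _ = 4 := by norm_num
  rw [probReal_univ, mul_one, Real.norm_eq_abs] at hcov
  linarith

theorem alphaCoeff_nonneg (P : Measure Ω) (X : ℕ → Ω → ℝ) (r : ℕ) : 0 ≤ alphaCoeff P X r := by
  refine Real.sSup_nonneg ?_
  rintro c ⟨s, t, f, g, i, j, -, -, -, -, -, rfl⟩
  positivity

theorem measurableSet_forall_le (s : ℕ) (u : ℝ) :
    MeasurableSet {x : Fin s → ℝ | ∀ a, x a ≤ u} := by
  rw [Set.ofPred_forall]
  exact .iInter fun a ↦ measurableSet_le (measurable_pi_apply a) measurable_const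

theorem isTestFunction_indicator {s : ℕ} (hs : 0 < s) (u : ℝ) :
    IsTestFunction ({x : Fin s → ℝ | ∀ a, x a ≤ u}.indicator 1) := by
  refine ⟨measurable_one.indicator (measurableSet_forall_le s u), fun x ↦ ?_,
    fun _ ↦ u, fun _ ↦ u + 1, ?_⟩
  · by_cases hx : x ∈ {x : Fin s → ℝ | ∀ a, x a ≤ u}
    · simp [Set.indicator_of_mem hx]
    · simp [Set.indicator_of_notMem hx]
  · have h1 : (fun _ ↦ u) ∈ {x : Fin s → ℝ | ∀ a, x a ≤ u} := fun _ ↦ le_rfl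
    have h2 : (fun _ ↦ u + 1) ∉ {x : Fin s → ℝ | ∀ a, x a ≤ u} := fun H ↦ by
      have := H ⟨0, hs⟩
      linarith
    rw [Set.indicator_of_mem h1, Set.indicator_of_notMem h2]
    exact one_ne_zero

theorem abs_measureReal_inter_sub_mul_le (hX : ∀ j, Measurable (X j)) (hstat : IsStationary P X)
    (u : ℝ) (p q r : ℕ) :
    |P.real (blockBelow X u 0 p ∩ blockBelow X u (p + r) q) -
      probBelow P X u p * probBelow P X u q| ≤ 4 * alphaCoeff P X r := by
  have hα := alphaCoeff_nonneg P X r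
  -- Empty blocks are treated apart: test functions must be non-constant, which excludes zero
  -- arguments.
  rcases Nat.eq_zero_or_pos p with rfl | hp
  · have : blockBelow X u 0 0 = Set.univ := by simp [blockBelow]
    rw [this, Set.univ_inter, measureReal_blockBelow hstat, probBelow_zero, one_mul, sub_self,
      abs_zero]
    positivity
  rcases Nat.eq_zero_or_pos q with rfl | hq
  · have : blockBelow X u (p + r) 0 = Set.univ := by simp [blockBelow]
    rw [this, Set.inter_univ, measureReal_blockBelow hstat, probBelow_zero, mul_one, sub_self,
      abs_zero]
    positivity
  have hA := measurableSet_blockBelow hX u 0 p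
  have hB := measurableSet_blockBelow hX u (p + r) q
  have hmem : |cov[(blockBelow X u 0 p).indicator 1, (blockBelow X u (p + r) q).indicator 1; P]| / 4
      ∈ alphaSet P X r := by
    refine ⟨p, q, _, _, fun a ↦ a + 0, fun b ↦ b + (p + r), isTestFunction_indicator hp u,
      isTestFunction_indicator hq u, fun _ _ H ↦ ?_, fun _ _ H ↦ ?_, fun a b ↦ ?_, ?_⟩
    · simpa using H
    · simpa using H
    · have := a.2
      simp only
      omega
    · rw [indicator_blockBelow, indicator_blockBelow]
  have hle := le_csSup (alphaSet_bddAbove P X r) hmem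
  have hL {S : Set Ω} (hS : MeasurableSet S) : MemLp (S.indicator (1 : Ω → ℝ)) 2 P :=
    memLp_indicator_const 2 hS 1 (Or.inr (measure_ne_top P S))
  rw [covariance_eq_sub (hL hA) (hL hB), ← Set.inter_indicator_one,
    integral_indicator_one (hA.inter hB), integral_indicator_one hA, integral_indicator_one hB,
    measureReal_blockBelow hstat, measureReal_blockBelow hstat] at hle
  rw [alphaCoeff]
  linarith

theorem isMaximumFamily_probBelow (hX : ∀ j, Measurable (X j)) (hstat : IsStationary P X)
    (hmix : IsAlphaMixing P X) (hcont : Continuous fun x : ℝ ↦ P.real {ω | X 0 ω ≤ x}) :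
    IsMaximumFamily (probBelow P X) where
  zero := probBelow_zero P X
  nonneg _ _ := measureReal_nonneg
  anti := antitone_probBelow P X
  mono := monotone_probBelow P X
  cont := continuous_probBelow hX hstat hcont
  step u n := probBelow_sub_add_le hX hstat u n 1
  approx_mul δ hδ := by
    obtain ⟨r, hr⟩ := (hmix.eventually_lt_const (u := δ / 8) (by positivity)).exists
    -- Each gap deletion costs at most δ/4, and mixing at most 4 · δ/8 = δ/2.
    refine ⟨δ / 4 / (r + 1), by positivity, fun u hu p q ↦ ?_⟩
    rw [lt_div_iff₀ (by positivity)] at hu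
    have hr1 := one_sub_probBelow_le hX hstat u r
    have hF := probBelow_le_one P X u 1
    have hsmall : 1 - probBelow P X u r ≤ δ / 4 := by linarith
    have hp1 := probBelow_le_one P X u p
    have hp0 : 0 ≤ probBelow P X u p := measureReal_nonneg
    rcases le_total q r with hqr | hqr
    · have h1 := probBelow_sub_add_le hX hstat u p q
      have h2 := antitone_probBelow P X u hqr
      have h3 := antitone_probBelow P X u (Nat.le_add_right p q)
      have h4 : probBelow P X u p * (1 - probBelow P X u q) ≤ 1 - probBelow P X u q :=
        mul_le_of_le_one_left (sub_nonneg.2 (probBelow_le_one P X u q)) hp1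
      have h5 : 0 ≤ probBelow P X u p * (1 - probBelow P X u q) :=
        mul_nonneg hp0 (sub_nonneg.2 (probBelow_le_one P X u q))
      rw [abs_le]
      constructor <;> linarith
    -- The gap is carved from the start of the second block. It is deleted once from the joint event
    -- and once from the second factor.
    · obtain ⟨m, rfl⟩ := Nat.exists_eq_add_of_le hqr
      have h1 := abs_le.1 (abs_measureReal_inter_sub_mul_le hX hstat u p m r)
      set A := blockBelow X u 0 p ∩ blockBelow X u (p + r) m with hA
      have h2 := measureReal_sub_inter_le hX hstat u A p r
      have h3 : A ∩ blockBelow X u p r = blockBelow X u 0 (p + (r + m)) := by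
        rw [← add_assoc, blockBelow_add, blockBelow_add, hA, Set.inter_right_comm]
      have h4 : P.real (A ∩ blockBelow X u p r) ≤ P.real A := measureReal_mono Set.inter_subset_left
      rw [h3] at h2 h4
      have h5 := probBelow_sub_add_le hX hstat u m r
      rw [add_comm m r] at h5
      have h6 := antitone_probBelow P X u (Nat.le_add_left m r)
      have h7 : probBelow P X u p * (probBelow P X u m - probBelow P X u (r + m)) ≤
          probBelow P X u m - probBelow P X u (r + m) :=
        mul_le_of_le_one_left (sub_nonneg.2 h6) hp1
      have h8 : 0 ≤ probBelow P X u p * (probBelow P X u m - probBelow P X u (r + m)) :=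
        mul_nonneg hp0 (sub_nonneg.2 h6)
      have h9 : P.real (blockBelow X u 0 (p + (r + m))) = probBelow P X u (p + (r + m)) := rfl
      rw [h9] at h2 h4
      rw [abs_le]
      constructor <;> linarith
  decay η hη δ hδ := by
    rcases lt_or_ge 1 η with h1 | h1
    · refine ⟨0, fun u hu ↦ ?_⟩
      have : 0 ≤ probBelow P X u 1 := measureReal_nonneg
      linarith
    obtain ⟨k, hk⟩ := exists_pow_lt_of_lt_one (show 0 < δ / 2 by positivity)
      (show 1 - η < 1 by linarith)
    obtain ⟨r, hr⟩ :=
      (hmix.eventually_lt_const (u := δ / (8 * (k + 1))) (by positivity)).exists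
    refine ⟨k * (r + 1), fun u hu ↦ ?_⟩
    have hα := alphaCoeff_nonneg P X r
    -- Only the last variable of each stretch of r + 1 is kept; each contributes a factor 1 - η and
    -- an error 4α(r). Since k is fixed before r, the total error k · 4α(r) stays below δ/2.
    have key (m : ℕ) : probBelow P X u (m * (r + 1)) ≤ (1 - η) ^ m + m * (4 * alphaCoeff P X r) := by
      induction m with
      | zero => simp [probBelow_zero]
      | succ m ih =>
        set p := m * (r + 1) with hp
        have h2 := (abs_le.1 (abs_measureReal_inter_sub_mul_le hX hstat u p 1 r)).2
        have h3 : probBelow P X u ((m + 1) * (r + 1)) ≤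
            P.real (blockBelow X u 0 p ∩ blockBelow X u (p + r) 1) := by
          rw [probBelow, show (m + 1) * (r + 1) = p + r + 1 by rw [hp]; ring, blockBelow_add,
            blockBelow_add]
          exact measureReal_mono (Set.inter_subset_inter_left _ Set.inter_subset_left)
        have h4 : 0 ≤ probBelow P X u p := measureReal_nonneg
        have h5 : probBelow P X u p * probBelow P X u 1 ≤
            ((1 - η) ^ m + m * (4 * alphaCoeff P X r)) * (1 - η) :=
          mul_le_mul ih hu measureReal_nonneg (h4.trans ih)
        have h6 : (m : ℝ) * (4 * alphaCoeff P X r) * (1 - η) ≤ m * (4 * alphaCoeff P X r) :=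
          mul_le_of_le_one_right (by positivity) (by linarith)
        rw [pow_succ]
        push_cast
        linarith
    rw [lt_div_iff₀ (by positivity)] at hr
    have := key k
    linarith
  lim_atBot := by
    have : IsProbabilityMeasure (P.map (X 0)) := Measure.isProbabilityMeasure_map (hX 0).aemeasurable
    refine (tendsto_cdf_atBot (P.map (X 0))).congr fun u ↦ ?_
    rw [cdf_eq_real, map_measureReal_apply (hX 0) measurableSet_Iic, probBelow_one]
    rfl
  lim_atTop := by
    have : IsProbabilityMeasure (P.map (X 0)) := Measure.isProbabilityMeasure_map (hX 0).aemeasurable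
    refine (tendsto_cdf_atTop (P.map (X 0))).congr fun u ↦ ?_
    rw [cdf_eq_real, map_measureReal_apply (hX 0) measurableSet_Iic, probBelow_one]
    rfl

end Mixing

end Phantom

theorem mainTheorem1 {Ω : Type*} [MeasurableSpace Ω] (P : Measure Ω) [IsProbabilityMeasure P]
    (X : ℕ → Ω → ℝ) (hX : ∀ j, Measurable (X j))
    (hstat : Phantom.IsStationary P X)
    (hmix : Phantom.IsAlphaMixing P X)
    (hcont : Continuous fun x : ℝ ↦ P.real {ω | X 0 ω ≤ x}) :
    ∃ G : ℝ → ℝ, Continuous G ∧ Phantom.IsPhantomDistributionFunction P X G := by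
  have hh := Phantom.isMaximumFamily_probBelow hX hstat hmix hcont
  refine ⟨_, hh.continuous_phantom, hh.isDistributionFunction_phantom, fun u ↦ ?_⟩
  rw [Metric.tendsto_nhds]
  intro δ hδ
  filter_upwards [hh.eventually_forall_abs_sub_phantom_pow_le (half_pos hδ),
    eventually_gt_atTop 0] with n hn hn0
  -- The case n = 0 is discarded, since the supremum over the empty `Fin 0` is only a default value.
  rw [Phantom.setOf_partialMax_le X (u n) hn0, dist_zero_right, Real.norm_eq_abs]
  exact (hn (u n)).trans_lt (half_lt_self hδ)
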